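/- Fix $L>0$ and put $\omega_L=\frac{2\pi^2}{L^2+2\pi^2}$ and $\Omega_L=-\frac{4\pi^2}{L^2}$. For $\omega<1$ consider the equation $$\phi''=\frac{\omega-\phi^2}{1-\phi^2}\,\phi ,\qquad \phi:\mathbb R\to(-1,1). \qquad (*)$$ By a periodic profile we mean a $C^\infty$ solution $\phi:\mathbb R\to(-1,1)$ of $(*)$ that is nonconstant and has least positive period $L$. (i) For every $\omega\in(\omega_L,1)$ there is a periodic profile $\phi$ with $0<\phi(x)<1$ for all $x\in\mathbb R$ such that, for every $x_0\in\mathbb R$, the translate $\phi(\cdot-x_0)$ is again a periodic profile and is even about $x_0$; that is, $\phi(x-x_0)=\phi(x_0-x)$ for all $x\in\mathbb R$. (ii) For every $\omega\in(\Omega_L,1)$ there is a periodic profile $\phi$ with $-1<\phi(x)<1$ for all $x\in\mathbb R$ such that, for every $x_0\in\mathbb R$, the translate $\phi(\cdot-x_0)$ is again a periodic profile, is odd about $x_0$, and is symmetric about the quarter period $x_0+\frac L4$; that is, $\phi(x-x_0)=-\phi(x_0-x)=\phi\left(\frac L2-x+x_0\right)$ for all $x\in\mathbb R$. -/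

import Mathlib

noncomputable section

/-- The threshold `ω_L = 2π² / (L² + 2π²)`. -/
def evenThreshold (L : ℝ) : ℝ := 2 * Real.pi ^ 2 / (L ^ 2 + 2 * Real.pi ^ 2)

/-- The threshold `Ω_L = -4π² / L²`. -/
def oddThreshold (L : ℝ) : ℝ := -(4 * Real.pi ^ 2 / L ^ 2)

/-- `L` is the least positive period of `f`. A constant function has no such period,
so that stationary points of the system are not periodic orbits. -/
def HasMinimalPeriod (f : ℝ → ℝ) (L : ℝ) : Prop :=
  IsLeast {T : ℝ | 0 < T ∧ Function.Periodic f T} L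

/-- `φ` is the smooth profile of a periodic orbit, with (least) period `L`, of
`φ'' = (ω - φ²) φ / (1 - φ²)`. -/
structure IsPeriodicProfile (ω L : ℝ) (φ : ℝ → ℝ) : Prop where
  smooth : ContDiff ℝ (⊤ : ℕ∞) φ
  period : HasMinimalPeriod φ L
  ode : ∀ x, deriv (deriv φ) x = (ω - φ x ^ 2) / (1 - φ x ^ 2) * φ x

/-- An even wave centred at `x₀`: values in `(0, 1)`, even about `x₀`. -/
structure IsEvenWave (ω L x₀ : ℝ) (φ : ℝ → ℝ) : Prop extends IsPeriodicProfile ω L φ where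
  range : ∀ x, 0 < φ x ∧ φ x < 1
  even : ∀ x, φ (x₀ + x) = φ (x₀ - x)

/-- An odd wave centred at `x₀`: values in `(-1, 1)`, odd about `x₀`, and symmetric about
the quarter period `x₀ + L / 4`. -/
structure IsOddWave (ω L x₀ : ℝ) (φ : ℝ → ℝ) : Prop extends IsPeriodicProfile ω L φ where
  range : ∀ x, -1 < φ x ∧ φ x < 1
  odd : ∀ x, φ (x₀ + x) = -φ (x₀ - x)
  quarter : ∀ x, φ (x₀ + x) = φ (x₀ + (L / 2 - x))

end

/-! Put `c = 1 - ω`. Solutions of the equation lie on energy levels `φ'² = φ² + c log (1 - φ²) + E`.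
Each wave is sought as an explicit function of an angle `Θ`: `φ = a sin Θ` in the odd case, `φ² = 1
- κ exp (-d cos Θ)` in the even case. The energy relation then factors: the zeros of `φ'` at the
turning points are carried by `cos Θ` or `sin Θ`, and what remains is a first-order equation `Θ' =
G(Θ)` with `G` continuous, positive and `2π`-periodic. The turning points, singular for the energy
integral, become regular.

Symmetries of `G` become symmetries of the wave, and its period is `∫₀^{2π} dθ / G(θ)`. It remains
to choose the amplitude parameter so that this integral equals `L`; `exists_arrivalTime_eq` does so
by the intermediate value theorem.

Even waves: as `d → 0` the orbit shrinks to the centre `√ω`, and the limiting period is below `L`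
exactly when `ω > ω_L`. As `d` increases to the value `q` at which the minimum of the wave reaches
`0`, the period blows up (`eventually_lt_arrivalTime`).

Odd waves: the period tends to `0` as `k → ∞`. A period above `L` comes from the linearization at
`0` when `ω < 0`, which is where `ω > Ω_L` enters, and from blow-up at a zero of the speed when `ω ≥
0`. -/

open Real Set Filter Topology MeasureTheory

/-! ### Energy levels and the profile equation. -/

/-- If `v` is the derivative of `u`, if `v² = P(u)` where `P` has derivative `2F`, and if `v` has only
countably many zeros, then `F(u)` is the derivative of `v`. -/
lemma hasDerivAt_of_sq_eq {u v F P : ℝ → ℝ} (hv : Continuous v)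
    (hu : ∀ t, HasDerivAt u (v t) t) (hsq : ∀ t, v t ^ 2 = P (u t))
    (hP : ∀ t, HasDerivAt P (2 * F (u t)) (u t)) (hF : Continuous fun t => F (u t))
    (hz : {t | v t = 0}.Countable) (t : ℝ) : HasDerivAt v (F (u t)) t := by
  have hpos : ∀ w : ℝ → ℝ, Continuous w → ∀ f s, HasDerivAt (fun t => w t ^ 2) (2 * f * w s) s →
      0 < w s → HasDerivAt w f s := by
    intro w hw f s hd hs
    have h1 := hd.sqrt (by positivity)
    have h2 : 2 * f * w s / (2 * √(w s ^ 2)) = f := by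
      rw [sqrt_sq hs.le]; field_simp
    rw [h2] at h1
    refine h1.congr_of_eventuallyEq ?_
    filter_upwards [hw.continuousAt.eventually (lt_mem_nhds hs)] with y hy
    rw [sqrt_sq hy.le]
  have hoff : ∀ s, v s ≠ 0 → HasDerivAt v (F (u s)) s := by
    intro s hs
    have hd : HasDerivAt (fun t => v t ^ 2) (2 * F (u s) * v s) s := by
      have := (hP s).comp s (hu s)
      exact this.congr_of_eventuallyEq (Eventually.of_forall hsq)
    rcases lt_or_gt_of_ne hs with h | h
    · have := hpos (fun t => -v t) hv.neg (-F (u s)) s (by simpa using hd) (by simpa using h)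
      exact this.neg.congr_deriv (neg_neg _) |>.congr_of_eventuallyEq
        (Eventually.of_forall fun t => (neg_neg (v t)).symm)
    · exact hpos v hv _ s hd h
  -- Where `v` vanishes the square root cannot be differentiated. The fundamental theorem of
  -- calculus tolerates countably many exceptional points, so `v` is a primitive of the continuous
  -- function `F ∘ u` and hence differentiable there too.
  have hint : ∀ s, ∫ x in (0 : ℝ)..s, F (u x) = v s - v 0 := fun s =>
    integral_eq_of_hasDerivAt_off_countable v _ hz hv.continuousOn
      (fun x hx => hoff x hx.2) (hF.intervalIntegrable _ _)
  have hderiv : HasDerivAt (fun s => v 0 + ∫ x in (0 : ℝ)..s, F (u x)) (F (u t)) t :=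
    (intervalIntegral.integral_hasDerivAt_right (hF.intervalIntegrable _ _)
      (hF.stronglyMeasurableAtFilter _ _) hF.continuousAt).const_add _
  refine hderiv.congr_of_eventuallyEq (Eventually.of_forall fun s => ?_)
  simp [hint s]

/-- A curve on a level set of the energy that is at rest only countably often is a smooth solution
of the profile equation. -/
lemma profile_of_energy {ω E : ℝ} {u v : ℝ → ℝ} (hv : Continuous v)
    (hu : ∀ t, HasDerivAt u (v t) t) (hrange : ∀ t, u t ^ 2 < 1)
    (hsq : ∀ t, v t ^ 2 = u t ^ 2 + (1 - ω) * log (1 - u t ^ 2) + E)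
    (hz : {t | v t = 0}.Countable) :
    ContDiff ℝ (⊤ : ℕ∞) u ∧
      ∀ x, deriv (deriv u) x = (ω - u x ^ 2) / (1 - u x ^ 2) * u x := by
  have hne : ∀ t, 1 - u t ^ 2 ≠ 0 := fun t => (sub_pos.2 (hrange t)).ne'
  have hsmooth : ∀ n : ℕ, ContDiff ℝ n u →
      ContDiff ℝ n fun t => (ω - u t ^ 2) / (1 - u t ^ 2) * u t := fun n h =>
    ((contDiff_const.sub (h.pow 2)).div (contDiff_const.sub (h.pow 2)) hne).mul h
  have hcont : Continuous u := continuous_iff_continuousAt.2 fun t => (hu t).continuousAt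
  have hv' := hasDerivAt_of_sq_eq (P := fun x => x ^ 2 + (1 - ω) * log (1 - x ^ 2) + E)
    (F := fun x => (ω - x ^ 2) / (1 - x ^ 2) * x) hv hu hsq (fun t => by
      have h1 : HasDerivAt (fun x : ℝ => x ^ 2) (2 * u t) (u t) := by
        simpa using hasDerivAt_pow 2 (u t)
      refine ((h1.add (((h1.const_sub 1).log (hne t)).const_mul (1 - ω))).add_const E).congr_deriv ?_
      have := hne t
      field_simp
      ring) (contDiff_zero.1 (hsmooth 0 (contDiff_zero.2 hcont))) hz
  have hdu : deriv u = v := funext fun t => (hu t).deriv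
  have hdv : deriv v = fun t => (ω - u t ^ 2) / (1 - u t ^ 2) * u t :=
    funext fun t => (hv' t).deriv
  refine ⟨contDiff_infty.2 fun n => ?_, fun x => by rw [hdu, hdv]⟩
  -- Bootstrap: if `u` is of class `C^n`, so is `v' = F(u)`, which makes `v` and then `u` more
  -- regular.
  induction n with
  | zero => exact contDiff_zero.2 hcont
  | succ n ih =>
    have key : ∀ m : ℕ, ∀ f : ℝ → ℝ, Differentiable ℝ f → ContDiff ℝ m (deriv f) →
        ContDiff ℝ (m + 1 : ℕ) f := fun m f h1 h2 => by
      push_cast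
      exact contDiff_succ_iff_deriv.2 ⟨h1, by simp, h2⟩
    have h2 : ContDiff ℝ (n + 1 : ℕ) v :=
      key n v (fun t => (hv' t).differentiableAt) (hdv ▸ hsmooth n ih)
    refine key n u (fun t => (hu t).differentiableAt) (hdu ▸ h2.of_le ?_)
    exact_mod_cast n.le_succ

/-! ### Motion on the circle and its travel time. -/

/-- The time at which a point moving on the line with speed `G`, starting at `0`, reaches `θ`. -/
noncomputable def arrivalTime (G : ℝ → ℝ) (θ : ℝ) : ℝ := ∫ x in (0 : ℝ)..θ, (G x)⁻¹

lemma intervalIntegrable_inv {G : ℝ → ℝ} (hG : Continuous G) (hpos : ∀ θ, 0 < G θ)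
    (a b : ℝ) : IntervalIntegrable (fun x => (G x)⁻¹) volume a b :=
  (hG.inv₀ fun x => (hpos x).ne').intervalIntegrable _ _

lemma hasDerivAt_arrivalTime {G : ℝ → ℝ} (hG : Continuous G) (hpos : ∀ θ, 0 < G θ)
    (θ : ℝ) : HasDerivAt (arrivalTime G) (G θ)⁻¹ θ := by
  have h : Continuous fun x => (G x)⁻¹ := hG.inv₀ fun x => (hpos x).ne'
  exact intervalIntegral.integral_hasDerivAt_right (h.intervalIntegrable _ _)
    (h.stronglyMeasurableAtFilter _ _) h.continuousAt

lemma arrivalTime_add_two_pi {G : ℝ → ℝ} (hG : Continuous G) (hpos : ∀ θ, 0 < G θ)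
    (hper : Function.Periodic G (2 * π)) (θ : ℝ) :
    arrivalTime G (θ + 2 * π) = arrivalTime G θ + arrivalTime G (2 * π) := by
  have hper' : Function.Periodic (fun x => (G x)⁻¹) (2 * π) := fun x => by simp [hper x]
  have h := hper'.intervalIntegral_add_eq θ 0
  rw [zero_add] at h
  unfold arrivalTime
  rw [← h, intervalIntegral.integral_add_adjacent_intervals] <;>
    exact intervalIntegrable_inv hG hpos _ _

lemma arrivalTime_neg {G : ℝ → ℝ}
    (heven : ∀ θ, G (-θ) = G θ) (θ : ℝ) :
    arrivalTime G (-θ) = -arrivalTime G θ := by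
  unfold arrivalTime
  have h := intervalIntegral.integral_comp_neg (fun x => (G x)⁻¹) (a := 0) (b := θ)
  simp only [heven, neg_zero] at h
  rw [h, intervalIntegral.integral_symm]

/-- This reflection yields the symmetry of the odd wave about its quarter period. -/
lemma arrivalTime_pi_sub {G : ℝ → ℝ} (hG : Continuous G) (hpos : ∀ θ, 0 < G θ)
    (hsym : ∀ θ, G (π - θ) = G θ) (θ : ℝ) :
    arrivalTime G (π - θ) = arrivalTime G π - arrivalTime G θ := by
  unfold arrivalTime
  have h := intervalIntegral.integral_comp_sub_left (fun x => (G x)⁻¹) π (a := 0) (b := θ)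
  simp only [hsym, sub_zero] at h
  rw [h, eq_sub_iff_add_eq, intervalIntegral.integral_add_adjacent_intervals] <;>
    exact intervalIntegrable_inv hG hpos _ _

/-- The motion of a point with speed `G` depending periodically on its position. -/
lemma exists_motion {G : ℝ → ℝ} (hG : Continuous G) (hpos : ∀ θ, 0 < G θ)
    (hper : Function.Periodic G (2 * π)) :
    ∃ Θ : ℝ → ℝ, StrictMono Θ ∧ (∀ t, HasDerivAt Θ (G (Θ t)) t) ∧
      (∀ θ, Θ (arrivalTime G θ) = θ) ∧ ∀ t, arrivalTime G (Θ t) = t := by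
  have hper' : Function.Periodic (fun x => (G x)⁻¹) (2 * π) := fun x => by simp [hper x]
  have hd := hasDerivAt_arrivalTime hG hpos
  have hcont : Continuous (arrivalTime G) :=
    continuous_iff_continuousAt.2 fun θ => (hd θ).continuousAt
  have hmono : StrictMono (arrivalTime G) := strictMono_of_deriv_pos fun θ => by
    rw [(hd θ).deriv]; exact inv_pos.2 (hpos θ)
  have hsurj : Function.Surjective (arrivalTime G) :=
    hcont.surjective
      (hper'.tendsto_atTop_intervalIntegral_of_pos' (intervalIntegrable_inv hG hpos _ _)
        (fun x => inv_pos.2 (hpos x)) two_pi_pos)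
      (hper'.tendsto_atBot_intervalIntegral_of_pos' (intervalIntegrable_inv hG hpos _ _)
        (fun x => inv_pos.2 (hpos x)) two_pi_pos)
  let e := StrictMono.orderIsoOfSurjective (arrivalTime G) hmono hsurj
  have he : ∀ t, arrivalTime G (e.symm t) = t := e.apply_symm_apply
  refine ⟨e.symm, e.symm.strictMono, fun t => ?_, e.symm_apply_apply, he⟩
  have := HasDerivAt.of_local_left_inverse e.symm.continuous.continuousAt (hd (e.symm t))
    (inv_pos.2 (hpos _)).ne' (Eventually.of_forall he)
  simpa using this

/-- The travel time around the circle depends continuously on the speed. -/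
lemma exists_arrivalTime_eq {G : ℝ → ℝ → ℝ} (hG : Continuous (Function.uncurry G)) {a b L : ℝ}
    (hab : a ≤ b) (hpos : ∀ p ∈ Icc a b, ∀ θ, 0 < G p θ)
    (hL : L ∈ uIcc (arrivalTime (G a) (2 * π)) (arrivalTime (G b) (2 * π))) :
    ∃ p ∈ Icc a b, arrivalTime (G p) (2 * π) = L := by
  -- Truncating the speed below at its minimum `ε` over the compact rectangle changes nothing for `p
  -- ∈ Icc a b`, but makes the integrand continuous for all parameters.
  obtain ⟨q, hq, hmin⟩ := (isCompact_Icc.prod isCompact_Icc).exists_isMinOn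
    (s := Icc a b ×ˢ Icc 0 (2 * π)) ⟨(a, 0), ⟨left_mem_Icc.2 hab, left_mem_Icc.2 two_pi_pos.le⟩⟩
    hG.continuousOn
  have hε : 0 < Function.uncurry G q := hpos q.1 hq.1 q.2
  set ε := Function.uncurry G q
  have hcont : Continuous fun p => arrivalTime (fun θ => max (G p θ) ε) (2 * π) := by
    refine intervalIntegral.continuous_parametric_intervalIntegral_of_continuous'
      (f := fun p θ => (max (G p θ) ε)⁻¹) ?_ _ _
    exact Continuous.inv₀ (hG.max continuous_const) fun x => (lt_max_of_lt_right hε).ne'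
  have heq : ∀ p ∈ Icc a b, arrivalTime (fun θ => max (G p θ) ε) (2 * π)
      = arrivalTime (G p) (2 * π) := by
    intro p hp
    refine intervalIntegral.integral_congr fun θ hθ => ?_
    rw [uIcc_of_le two_pi_pos.le] at hθ
    have : ε ≤ G p θ := hmin (show (p, θ) ∈ _ from ⟨hp, hθ⟩)
    simp [max_eq_left this]
  rw [← heq a (left_mem_Icc.2 hab), ← heq b (right_mem_Icc.2 hab)] at hL
  obtain ⟨p, hp, hpL⟩ := intermediate_value_uIcc (hcont.continuousOn) hL
  rw [uIcc_of_le hab] at hp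
  exact ⟨p, hp, by rw [← heq p hp]; exact hpL⟩

/-- If the speed vanishes linearly at a point for the parameter `q`, then the travel time around
the circle blows up as the parameter tends to `q`. -/
lemma eventually_lt_arrivalTime {G : ℝ → ℝ → ℝ} (hG : Continuous (Function.uncurry G)) {q C : ℝ}
    (hC : 0 < C) (h0 : ∀ θ, 0 ≤ G q θ) (hle : ∀ θ ∈ Icc 0 (2 * π), G q θ ≤ C * |θ - π|) (L : ℝ) :
    ∀ᶠ p in 𝓝 q, (∀ θ, 0 < G p θ) → L < arrivalTime (G p) (2 * π) := by
  obtain ⟨ε, hε, hεL⟩ : ∃ ε : ℝ, 0 < ε ∧ L < C⁻¹ * log ((C * π + ε) / ε) := by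
    -- With this `ε` the quotient `(C * π + ε) / ε` equals `exp (C * L) + 1`.
    refine ⟨C * π * exp (-(C * L)), by positivity, ?_⟩
    rw [inv_mul_eq_div, lt_div_iff₀ hC, lt_log_iff_exp_lt (by positivity),
      lt_div_iff₀ (by positivity)]
    have : exp (L * C) * (C * π * exp (-(C * L))) = C * π := by
      rw [mul_comm L, exp_neg]; field_simp
    rw [this]
    have : 0 < C * π * exp (-(C * L)) := by positivity
    linarith
  -- The speed `|G| + ε` never vanishes, so its travel time is continuous even at `q`; where `G p`
  -- is positive, it is a lower bound for the true travel time.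
  let H : ℝ → ℝ → ℝ := fun p θ => |G p θ| + ε
  have hHpos : ∀ p θ, 0 < H p θ := fun p θ => by positivity
  have hH : Continuous (Function.uncurry H) := hG.abs.add continuous_const
  have hHp : ∀ p, Continuous (H p) := fun p => hH.uncurry_left p
  have hcont : Continuous fun p => arrivalTime (H p) (2 * π) :=
    intervalIntegral.continuous_parametric_intervalIntegral_of_continuous'
      (f := fun p θ => (H p θ)⁻¹) (hH.inv₀ fun x => (hHpos x.1 x.2).ne') _ _
  have hq : L < arrivalTime (H q) (2 * π) := by
    refine hεL.trans_le ?_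
    have hpi := pi_pos
    have hB : ∀ θ ∈ Icc π (2 * π), 0 < C * (θ - π) + ε := fun θ hθ => by
      have := mul_nonneg hC.le (sub_nonneg.2 hθ.1); linarith
    have hcB : ContinuousOn (fun θ => (C * (θ - π) + ε)⁻¹) (uIcc π (2 * π)) := by
      rw [uIcc_of_le (by linarith)]
      exact ContinuousOn.inv₀ (by fun_prop) fun θ hθ => (hB θ hθ).ne'
    have h1 : ∫ θ in π..(2 * π), (C * (θ - π) + ε)⁻¹ = C⁻¹ * log ((C * π + ε) / ε) := by
      rw [intervalIntegral.integral_eq_sub_of_hasDerivAt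
        (f := fun θ => C⁻¹ * log (C * (θ - π) + ε)) _ hcB.intervalIntegrable]
      · rw [log_div (by positivity) hε.ne']
        ring_nf
      · intro θ hθ
        rw [uIcc_of_le (by linarith)] at hθ
        have hb := (hB θ hθ).ne'
        refine ((((((hasDerivAt_id θ).sub_const π).const_mul C).add_const ε).log hb).const_mul
          C⁻¹).congr_deriv ?_
        simp only [id]
        field_simp
    rw [← h1]
    unfold arrivalTime
    rw [← intervalIntegral.integral_add_adjacent_intervals
      (intervalIntegrable_inv (hHp q) (hHpos q) 0 π)
      (intervalIntegrable_inv (hHp q) (hHpos q) π (2 * π))]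
    have h2 : 0 ≤ ∫ θ in (0 : ℝ)..π, (H q θ)⁻¹ :=
      intervalIntegral.integral_nonneg hpi.le fun θ _ => (inv_pos.2 (hHpos q θ)).le
    have h3 : ∫ θ in π..(2 * π), (C * (θ - π) + ε)⁻¹ ≤ ∫ θ in π..(2 * π), (H q θ)⁻¹ := by
      refine intervalIntegral.integral_mono_on (by linarith) hcB.intervalIntegrable
        (intervalIntegrable_inv (hHp q) (hHpos q) _ _) fun θ hθ => ?_
      refine inv_anti₀ (hHpos q θ) ?_
      have := hle θ ⟨by linarith [hθ.1], hθ.2⟩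
      rw [abs_of_nonneg (sub_nonneg.2 hθ.1)] at this
      simp only [H, abs_of_nonneg (h0 θ)]
      linarith
    linarith
  filter_upwards [hcont.continuousAt.eventually (lt_mem_nhds hq)] with p hp hGp
  refine hp.trans_le ?_
  refine intervalIntegral.integral_mono_on two_pi_pos.le
    (intervalIntegrable_inv (hHp p) (hHpos p) _ _)
    (intervalIntegrable_inv (hG.uncurry_left p) hGp _ _)
    fun θ _ => ?_
  refine inv_anti₀ (hGp θ) ?_
  simp only [H, abs_of_pos (hGp θ)]
  linarith

lemma HasMinimalPeriod.comp_sub_const {f : ℝ → ℝ} {L : ℝ} (h : HasMinimalPeriod f L) (x₀ : ℝ) :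
    HasMinimalPeriod (fun x => f (x - x₀)) L := by
  refine ⟨⟨h.1.1, fun x => ?_⟩, fun T hT => h.2 ⟨hT.1, fun x => ?_⟩⟩
  · have := h.1.2 (x - x₀)
    simpa [add_sub_right_comm] using this
  · have := hT.2 (x + x₀)
    simpa [add_sub_right_comm] using this

lemma IsPeriodicProfile.comp_sub_const {ω L : ℝ} {φ : ℝ → ℝ} (h : IsPeriodicProfile ω L φ)
    (x₀ : ℝ) : IsPeriodicProfile ω L fun x => φ (x - x₀) where
  smooth := h.smooth.comp (contDiff_id.sub contDiff_const)
  period := h.period.comp_sub_const x₀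
  ode x := by
    have : deriv (fun x => φ (x - x₀)) = fun x => deriv φ (x - x₀) :=
      funext fun x => deriv_comp_sub_const ..
    rw [this, deriv_comp_sub_const, h.ode]

/-! ### Odd waves. -/

/-- The function `log (1 + z) / z`, continued continuously to `z = 0`, for `0 ≤ z`. -/
noncomputable def logQuot (z : ℝ) : ℝ := ∫ t in (0 : ℝ)..1, (1 + |t * z|)⁻¹

lemma continuous_inv_one_add_abs : Continuous (Function.uncurry fun z t : ℝ => (1 + |t * z|)⁻¹) :=
  Continuous.inv₀ (by fun_prop) fun x => by positivity

lemma intervalIntegrable_inv_one_add_abs (z a b : ℝ) :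
    IntervalIntegrable (fun t : ℝ => (1 + |t * z|)⁻¹) volume a b :=
  (continuous_inv_one_add_abs.comp
    (by fun_prop : Continuous fun t : ℝ => (z, t))).intervalIntegrable _ _

lemma continuous_logQuot : Continuous logQuot :=
  intervalIntegral.continuous_parametric_intervalIntegral_of_continuous'
    continuous_inv_one_add_abs _ _

lemma logQuot_zero : logQuot 0 = 1 := by simp [logQuot]

lemma mul_logQuot {z : ℝ} (hz : 0 ≤ z) : z * logQuot z = log (1 + z) := by
  unfold logQuot
  rw [← intervalIntegral.integral_const_mul,
    intervalIntegral.integral_eq_sub_of_hasDerivAt (f := fun t => log (1 + t * z))]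
  · simp
  · intro t ht
    rw [uIcc_of_le zero_le_one] at ht
    have h0 : 0 ≤ t * z := mul_nonneg ht.1 hz
    refine ((((hasDerivAt_id t).mul_const z).const_add 1).log
      (by simp only [id]; positivity)).congr_deriv ?_
    simp only [id, abs_of_nonneg h0]
    ring
  · exact (intervalIntegrable_inv_one_add_abs z 0 1).const_mul z

lemma logQuot_anti {z w : ℝ} (hz : 0 ≤ z) (hzw : z ≤ w) : logQuot w ≤ logQuot z := by
  refine intervalIntegral.integral_mono_on zero_le_one (intervalIntegrable_inv_one_add_abs ..)
    (intervalIntegrable_inv_one_add_abs ..) fun t ht => ?_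
  refine inv_anti₀ (by positivity) ?_
  rw [abs_of_nonneg (mul_nonneg ht.1 hz), abs_of_nonneg (mul_nonneg ht.1 (hz.trans hzw))]
  gcongr
  exact ht.1

/-- The integrand is 1-Lipschitz in `z`. This bounds the squared speed at the critical amplitude by
a multiple of `sin θ ^ 2`. -/
lemma logQuot_le_add {z w : ℝ} (hz : 0 ≤ z) (hzw : z ≤ w) :
    logQuot z ≤ logQuot w + (w - z) := by
  have h : logQuot z ≤ ∫ t in (0 : ℝ)..1, ((1 + |t * w|)⁻¹ + (w - z)) := by
    refine intervalIntegral.integral_mono_on zero_le_one (intervalIntegrable_inv_one_add_abs ..)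
      ((intervalIntegrable_inv_one_add_abs ..).add intervalIntegrable_const) fun t ht => ?_
    have h1 := mul_nonneg ht.1 hz
    have h2 := mul_nonneg ht.1 (hz.trans hzw)
    have h3 : t * (w - z) ≤ w - z := mul_le_of_le_one_left (sub_nonneg.2 hzw) ht.2
    have h4 : 0 ≤ t * (w - z) := mul_nonneg ht.1 (sub_nonneg.2 hzw)
    rw [abs_of_nonneg h1, abs_of_nonneg h2, ← sub_le_iff_le_add',
      inv_sub_inv (by positivity) (by positivity)]
    refine (div_le_of_le_mul₀ (by positivity) (sub_nonneg.2 hzw) ?_)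
    nlinarith [mul_nonneg h1 h2, mul_nonneg (sub_nonneg.2 hzw)
      (add_nonneg (add_nonneg h1 h2) (mul_nonneg h1 h2))]
  rwa [intervalIntegral.integral_add (intervalIntegrable_inv_one_add_abs ..)
    intervalIntegrable_const, intervalIntegral.integral_const, sub_zero, one_smul] at h

/-- The angular speed of the odd wave `√(k / (1 + k)) sin θ`, where `c = 1 - ω`. -/
noncomputable def oddSpeed (c k θ : ℝ) : ℝ := √(c * (1 + k) * logQuot (k * cos θ ^ 2) - 1)

lemma continuous_oddSpeed (c : ℝ) : Continuous (Function.uncurry (oddSpeed c)) := by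
  have := continuous_logQuot
  unfold oddSpeed Function.uncurry
  fun_prop

lemma oddSpeed_periodic (c k : ℝ) : Function.Periodic (oddSpeed c k) (2 * π) := fun θ => by
  simp [oddSpeed]

lemma sqrt_le_oddSpeed {c k : ℝ} (hc : 0 ≤ c) (hk : 0 ≤ k) (θ : ℝ) :
    √(c * (1 + k) * logQuot k - 1) ≤ oddSpeed c k θ := by
  refine sqrt_le_sqrt (sub_le_sub_right (mul_le_mul_of_nonneg_left ?_ (by positivity)) 1)
  exact logQuot_anti (by positivity) (mul_le_of_le_one_right hk (cos_sq_le_one θ))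

/-- By `mul_logQuot`, `(1 + k) * logQuot k` dominates `log (1 + k)`. -/
lemma tendsto_mul_logQuot {c : ℝ} (hc : 0 < c) :
    Tendsto (fun k => c * (1 + k) * logQuot k) atTop atTop := by
  have h : Tendsto (fun k => c * log (1 + k)) atTop atTop :=
    (tendsto_log_atTop.comp (tendsto_atTop_add_const_left _ 1 tendsto_id)).const_mul_atTop hc
  refine tendsto_atTop_mono' _ ?_ h
  filter_upwards [eventually_ge_atTop 0] with k hk
  rw [← mul_logQuot hk, mul_assoc]
  have : 0 ≤ logQuot k := intervalIntegral.integral_nonneg zero_le_one fun t _ => by positivity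
  gcongr
  linarith

lemma eventually_arrivalTime_oddSpeed_le {c L : ℝ} (hc : 0 < c) (hL : 0 < L) :
    ∀ᶠ k in atTop, arrivalTime (oddSpeed c k) (2 * π) ≤ L := by
  filter_upwards [(tendsto_mul_logQuot hc).eventually_ge_atTop (1 + (2 * π / L) ^ 2),
    eventually_ge_atTop 0] with k hk hk0
  have hpi := pi_pos
  have hle : ∀ θ, 2 * π / L ≤ oddSpeed c k θ := fun θ =>
    le_trans (le_sqrt_of_sq_le (by linarith)) (sqrt_le_oddSpeed hc.le hk0 θ)
  have hpos : ∀ θ, 0 < oddSpeed c k θ := fun θ => lt_of_lt_of_le (by positivity) (hle θ)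
  have hcont : Continuous (oddSpeed c k) :=
    (continuous_oddSpeed c).uncurry_left k
  calc arrivalTime (oddSpeed c k) (2 * π) ≤ ∫ _ in (0 : ℝ)..(2 * π), (2 * π / L)⁻¹ :=
        intervalIntegral.integral_mono_on two_pi_pos.le (intervalIntegrable_inv hcont hpos _ _)
          intervalIntegrable_const fun θ _ => inv_anti₀ (by positivity) (hle θ)
    _ = L := by
        rw [intervalIntegral.integral_const, smul_eq_mul, sub_zero]
        field_simp

/-- Amplitudes of odd waves with prescribed period `L`. -/
lemma exists_oddSpeed {L ω : ℝ} (hL : 0 < L) (hω : oddThreshold L < ω) (hω1 : ω < 1) :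
    ∃ k, 0 < k ∧ (∀ θ, 0 < oddSpeed (1 - ω) k θ) ∧
      arrivalTime (oddSpeed (1 - ω) k) (2 * π) = L := by
  have hc : 0 < 1 - ω := by linarith
  have hω' : 1 - ω < 1 + 4 * π ^ 2 / L ^ 2 := by unfold oddThreshold at hω; linarith
  generalize 1 - ω = c at *
  have hpos : ∀ k, 0 ≤ k → 1 < c * (1 + k) * logQuot k → ∀ θ, 0 < oddSpeed c k θ :=
    fun k hk h θ => lt_of_lt_of_le (sqrt_pos.2 (by linarith)) (sqrt_le_oddSpeed hc.le hk θ)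
  have hsolve : ∀ a, 0 ≤ a → (∀ k, a ≤ k → 1 < c * (1 + k) * logQuot k) →
      L < arrivalTime (oddSpeed c a) (2 * π) →
      ∃ k, 0 < k ∧ (∀ θ, 0 < oddSpeed c k θ) ∧ arrivalTime (oddSpeed c k) (2 * π) = L := by
    intro a ha hm hT
    obtain ⟨b, hb, hab⟩ :=
      ((eventually_arrivalTime_oddSpeed_le hc hL).and (eventually_ge_atTop a)).exists
    have hp : ∀ k, a ≤ k → ∀ θ, 0 < oddSpeed c k θ := fun k hk => hpos k (ha.trans hk) (hm k hk)
    obtain ⟨k, hk, hkL⟩ := exists_arrivalTime_eq (continuous_oddSpeed c) hab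
      (fun k hk => hp k hk.1) (mem_uIcc_of_ge hb hT.le)
    -- The endpoint `k = a` is excluded because its travel time exceeds `L`; this gives `0 < k` even
    -- when `a = 0`.
    refine ⟨k, ha.trans_lt (hk.1.lt_of_ne ?_), hp k hk.1, hkL⟩
    rintro rfl
    exact hT.ne' hkL
  have hcont : Continuous fun k => c * (1 + k) * logQuot k := by
    have := continuous_logQuot
    fun_prop
  -- If `ω < 0`, the speed stays positive down to `k = 0`, where it is the constant `√(c - 1)`, the
  -- frequency of the linearization at the origin. If `ω ≥ 0`, amplitudes start just above the
  -- largest `q` at which the minimal speed degenerates.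
  rcases lt_or_ge 1 c with h1 | h1
  · refine hsolve 0 le_rfl (fun k hk => ?_) ?_
    · have h2 := mul_logQuot hk
      have h3 : k / (1 + k) ≤ log (1 + k) := by
        have := one_sub_inv_le_log_of_pos (by linarith : 0 < 1 + k)
        convert this using 1
        field_simp
        ring
      have h4 : 1 ≤ (1 + k) * logQuot k := by
        rcases hk.eq_or_lt with rfl | hk'
        · simp [logQuot_zero]
        · rw [div_le_iff₀ (by linarith), ← h2] at h3
          nlinarith
      nlinarith
    · have h2 : arrivalTime (oddSpeed c 0) (2 * π) = 2 * π * (√(c - 1))⁻¹ := by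
        simp [arrivalTime, oddSpeed, logQuot_zero]
      have h3 : 0 < √(c - 1) := sqrt_pos.2 (by linarith)
      have h4 : √(c - 1) < 2 * π / L := by
        have hpi := pi_pos
        rw [sqrt_lt' (by positivity), div_pow, show (2 * π) ^ 2 = 4 * π ^ 2 by ring]
        linarith
      rw [h2, ← div_eq_mul_inv, lt_div_iff₀ h3]
      rwa [lt_div_iff₀ hL, mul_comm] at h4
  · obtain ⟨B, hB⟩ := eventually_atTop.1 ((tendsto_mul_logQuot hc).eventually_gt_atTop 1)
    have hcomp : IsCompact (Ici 0 ∩ {k | c * (1 + k) * logQuot k ≤ 1}) := by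
      refine isCompact_Icc (a := (0 : ℝ)) (b := B) |>.of_isClosed_subset
        (isClosed_Ici.inter (isClosed_le hcont continuous_const)) fun k hk => ⟨hk.1, ?_⟩
      by_contra h
      exact absurd hk.2 (not_le.2 (hB k (not_le.1 h).le))
    obtain ⟨q, ⟨hq0, hq1⟩, hq⟩ := hcomp.exists_isGreatest
      ⟨0, self_mem_Ici, by simpa [logQuot_zero] using h1⟩
    simp only [mem_Ici, mem_ofPred_eq] at hq0 hq1
    have hgt : ∀ k, q < k → 1 < c * (1 + k) * logQuot k := fun k hk => by
      by_contra h
      exact absurd (hq ⟨hq0.trans hk.le, not_lt.1 h⟩) (not_le.2 hk)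
    have hblow := eventually_lt_arrivalTime (continuous_oddSpeed c) (q := q)
      (C := √(c * (1 + q) * q) + 1) (by positivity) (fun θ => sqrt_nonneg _) (fun θ _ => by
        have h2 : oddSpeed c q θ ≤ √(c * (1 + q) * q * |θ - π| ^ 2) := by
          refine sqrt_le_sqrt ?_
          have h3 := logQuot_le_add (z := q * cos θ ^ 2) (w := q) (by positivity)
            (mul_le_of_le_one_right hq0 (cos_sq_le_one θ))
          have h4 : sin θ ^ 2 ≤ |θ - π| ^ 2 := by
            have := abs_sin_le_abs (x := θ - π)
            rw [sin_sub_pi, abs_neg] at this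
            rw [← sq_abs (sin θ)]
            gcongr
          have h5 : q - q * cos θ ^ 2 = q * sin θ ^ 2 := by rw [sin_sq]; ring
          have h6 := mul_le_mul_of_nonneg_left h3 (by positivity : 0 ≤ c * (1 + q))
          have h7 := mul_le_mul_of_nonneg_left h4 (by positivity : 0 ≤ c * (1 + q) * q)
          rw [h5] at h6
          linarith
        rw [sqrt_mul (by positivity), sqrt_sq (abs_nonneg _)] at h2
        have := abs_nonneg (θ - π)
        linarith) L
    obtain ⟨a, ha, hqa⟩ := ((hblow.filter_mono nhdsWithin_le_nhds).and
      (self_mem_nhdsWithin (s := Ioi q))).exists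
    have ha0 : 0 ≤ a := hq0.trans (le_of_lt hqa)
    exact hsolve a ha0 (fun k hk => hgt k (lt_of_lt_of_le hqa hk)) (ha (hpos a ha0 (hgt a hqa)))

lemma countable_setOf_sin_eq_zero : {θ : ℝ | sin θ = 0}.Countable :=
  (countable_range fun n : ℤ => (n : ℝ) * π).mono fun _ h => sin_eq_zero_iff.1 h

lemma countable_setOf_cos_eq_zero : {θ : ℝ | cos θ = 0}.Countable :=
  (countable_range fun n : ℤ => (2 * (n : ℝ) + 1) * π / 2).mono fun _ h => by
    obtain ⟨k, hk⟩ := cos_eq_zero_iff.1 h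
    exact ⟨k, hk.symm⟩

lemma exists_odd_wave {L ω : ℝ} (hL : 0 < L) (hω : oddThreshold L < ω) (hω1 : ω < 1) :
    ∃ φ : ℝ → ℝ, IsOddWave ω L 0 φ := by
  obtain ⟨k, hk, hpos, hT⟩ := exists_oddSpeed hL hω hω1
  set G := oddSpeed (1 - ω) k with hGdef
  have hG : Continuous G :=
    (continuous_oddSpeed _).uncurry_left k
  have hper : Function.Periodic G (2 * π) := oddSpeed_periodic _ k
  obtain ⟨Θ, hmono, hd, hleft, hright⟩ := exists_motion hG hpos hper
  have heven : ∀ θ, G (-θ) = G θ := fun θ => by simp [hGdef, oddSpeed]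
  have hsym : ∀ θ, G (π - θ) = G θ := fun θ => by simp [hGdef, oddSpeed]
  have hneg : ∀ t, Θ (-t) = -Θ t := fun t => by
    rw [← hleft (-Θ t), arrivalTime_neg heven, hright]
  have hadd : ∀ t, Θ (t + L) = Θ t + 2 * π := fun t => by
    rw [← hleft (Θ t + 2 * π), arrivalTime_add_two_pi hG hpos hper, hright, hT]
  have hhalf : arrivalTime G π = L / 2 := by
    have h1 := arrivalTime_pi_sub hG hpos hsym (-π)
    rw [arrivalTime_neg heven, show π - -π = 2 * π by ring, hT] at h1
    linarith
  have hpi : ∀ t, Θ (L / 2 - t) = π - Θ t := fun t => by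
    rw [← hleft (π - Θ t), arrivalTime_pi_sub hG hpos hsym, hright, hhalf]
  set a := √(k / (1 + k)) with ha
  have ha2 : a ^ 2 = k / (1 + k) := sq_sqrt (by positivity)
  have ha0 : 0 < a := sqrt_pos.2 (by positivity)
  have ha1 : a ^ 2 < 1 := by rw [ha2, div_lt_one (by positivity)]; linarith
  have hΘc : Continuous Θ := continuous_iff_continuousAt.2 fun t => (hd t).continuousAt
  have hrange : ∀ t, (a * sin (Θ t)) ^ 2 < 1 := fun t => by
    rw [mul_pow]
    exact (mul_le_of_le_one_right (sq_nonneg a) (sin_sq_le_one _)).trans_lt ha1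
  -- `E` is the energy for which the turning points are `±a`, since `1 - a ^ 2 = 1 / (1 + k)`.
  obtain ⟨hsmooth, hode⟩ := profile_of_energy (ω := ω) (u := fun t => a * sin (Θ t))
    (v := fun t => a * (cos (Θ t) * G (Θ t))) (E := (1 - ω) * log (1 + k) - a ^ 2)
    (by fun_prop) (fun t => ((hd t).sin.const_mul a)) hrange (fun t => by
      have hz : 0 ≤ k * cos (Θ t) ^ 2 := by positivity
      have h1 : G (Θ t) ^ 2 = (1 - ω) * (1 + k) * logQuot (k * cos (Θ t) ^ 2) - 1 :=
        sq_sqrt (sqrt_pos.1 (hpos _)).le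
      have h2 : 1 - (a * sin (Θ t)) ^ 2 = (1 + k * cos (Θ t) ^ 2) / (1 + k) := by
        rw [mul_pow, ha2, sin_sq]; field_simp; ring
      rw [h2, log_div (by positivity) (by positivity), ← mul_logQuot hz, mul_pow, mul_pow, h1,
        mul_pow, sin_sq]
      have h3 : a ^ 2 * (1 + k) = k := by rw [ha2]; field_simp
      linear_combination (1 - ω) * cos (Θ t) ^ 2 * logQuot (k * cos (Θ t) ^ 2) * h3)
    ((countable_setOf_cos_eq_zero.preimage hmono.injective).mono fun t ht => by
      rcases mul_eq_zero.1 ht with h | h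
      · exact absurd h ha0.ne'
      · exact (mul_eq_zero.1 h).resolve_right (hpos _).ne')
  refine ⟨fun t => a * sin (Θ t), ⟨⟨hsmooth, ⟨⟨hL, fun t => ?_⟩, fun T ⟨hT0, hTper⟩ => ?_⟩, hode⟩,
    fun t => ?_, fun t => ?_, fun t => ?_⟩⟩
  · simp [hadd]
  -- Compare with the crest `Θ = π / 2`: after a time shorter than `L` the angle has made less than
  -- one full turn, so the sine cannot be `1` again.
  · by_contra! hTL
    set s := arrivalTime G (π / 2)
    have hs : Θ s = π / 2 := hleft _
    have h1 := hTper s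
    simp only [hs, sin_pi_div_two, mul_one] at h1
    have h2 : sin (Θ (s + T)) = 1 := by
      have := mul_left_cancel₀ ha0.ne' (h1.trans (mul_one a).symm)
      exact this
    have h3 : Θ s < Θ (s + T) := hmono (by linarith)
    have h4 : Θ (s + T) < Θ s + 2 * π := by rw [← hadd]; exact hmono (by linarith)
    rw [hs] at h3 h4
    have h5 : cos (Θ (s + T) - π / 2) = 1 := by rw [cos_sub_pi_div_two, h2]
    have h6 := (cos_eq_one_iff_of_lt_of_lt (by linarith) (by linarith)).1 h5
    linarith
  · have := abs_lt.1 ((sq_lt_one_iff_abs_lt_one _).1 (hrange t))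
    exact this
  · simp [hneg]
  · simp [hpi]

/-! ### Even waves. -/

/-- The function `sinh d / d`, continued continuously to `d = 0`. -/
noncomputable def sinhQuot (d : ℝ) : ℝ := ∫ t in (0 : ℝ)..1, cosh (t * d)

lemma continuous_sinhQuot : Continuous sinhQuot :=
  intervalIntegral.continuous_parametric_intervalIntegral_of_continuous'
    (f := fun d t => cosh (t * d)) (by unfold Function.uncurry; fun_prop) _ _

lemma sinhQuot_pos (d : ℝ) : 0 < sinhQuot d :=
  intervalIntegral.intervalIntegral_pos_of_pos_on
    ((by fun_prop : Continuous fun t : ℝ => cosh (t * d)).intervalIntegrable _ _)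
    (fun t _ => cosh_pos _) zero_lt_one

lemma sinhQuot_zero : sinhQuot 0 = 1 := by simp [sinhQuot]

lemma mul_sinhQuot (d : ℝ) : d * sinhQuot d = sinh d := by
  unfold sinhQuot
  rw [← intervalIntegral.integral_const_mul,
    intervalIntegral.integral_eq_sub_of_hasDerivAt (f := fun t => sinh (t * d))]
  · simp
  · intro t _
    refine (((hasDerivAt_id t).mul_const d).sinh).congr_deriv ?_
    simp only [id]
    ring
  · exact (by fun_prop : Continuous fun t : ℝ => d * cosh (t * d)).intervalIntegrable _ _

/-- The function `(1 - (1 + z) e⁻ᶻ) / z²`, continued continuously to `z = 0`. -/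
noncomputable def expMoment (z : ℝ) : ℝ := ∫ t in (0 : ℝ)..1, t * exp (-(t * z))

lemma continuous_expMoment : Continuous expMoment :=
  intervalIntegral.continuous_parametric_intervalIntegral_of_continuous'
    (f := fun z t => t * exp (-(t * z))) (by unfold Function.uncurry; fun_prop) _ _

lemma expMoment_pos (z : ℝ) : 0 < expMoment z :=
  intervalIntegral.intervalIntegral_pos_of_pos_on
    ((by fun_prop : Continuous fun t : ℝ => t * exp (-(t * z))).intervalIntegrable _ _)
    (fun t ht => mul_pos ht.1 (exp_pos _)) zero_lt_one

lemma expMoment_zero : expMoment 0 = 1 / 2 := by simp [expMoment]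

lemma sq_mul_expMoment (z : ℝ) : z ^ 2 * expMoment z = 1 - (1 + z) * exp (-z) := by
  unfold expMoment
  rw [← intervalIntegral.integral_const_mul,
    intervalIntegral.integral_eq_sub_of_hasDerivAt (f := fun t => -((1 + t * z) * exp (-(t * z))))]
  · simp
    ring
  · intro t _
    have h := ((hasDerivAt_id t).mul_const z)
    refine ((h.const_add 1).mul h.neg.exp).neg.congr_deriv ?_
    simp only [id, Pi.neg_apply]
    ring
  · exact (by fun_prop : Continuous fun t : ℝ =>
      z ^ 2 * (t * exp (-(t * z)))).intervalIntegrable _ _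

/-- The gap between `x ↦ e^{-dx}` and its chord over `[-1, 1]`, divided by `d² (1 - x²)`. -/
noncomputable def chordGap (d x : ℝ) : ℝ :=
  (1 + x) / 2 * exp d * expMoment (d * (1 + x)) +
    (1 - x) / 2 * exp (-d) * expMoment (-(d * (1 - x)))

lemma continuous_chordGap : Continuous (Function.uncurry chordGap) := by
  have := continuous_expMoment
  unfold chordGap Function.uncurry
  fun_prop

lemma chordGap_zero (x : ℝ) : chordGap 0 x = 1 / 2 := by
  simp [chordGap, expMoment_zero]
  ring

/-- Both terms are nonnegative, and the first vanishes only at `x = -1`, where the second is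
positive. -/
lemma chordGap_pos (d : ℝ) {x : ℝ} (h₁ : -1 ≤ x) (h₂ : x ≤ 1) : 0 < chordGap d x := by
  have hm := expMoment_pos
  unfold chordGap
  rcases h₁.eq_or_lt with rfl | h
  · have := hm (-(d * (1 - -1)))
    norm_num at this ⊢
    positivity
  · have ha : 0 < (1 + x) / 2 * exp d * expMoment (d * (1 + x)) :=
      mul_pos (mul_pos (by linarith) (exp_pos _)) (hm _)
    have hb : 0 ≤ (1 - x) / 2 * exp (-d) * expMoment (-(d * (1 - x))) :=
      mul_nonneg (mul_nonneg (by linarith) (exp_pos _).le) (hm _).le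
    linarith

/-- For `x = cos θ` the right side is the squared velocity of the even wave divided by `κ`; the
factor `1 - x ^ 2 = sin θ ^ 2` isolates its zeros at the two turning points. -/
lemma mul_chordGap (d x : ℝ) :
    d ^ 2 * (1 - x ^ 2) * chordGap d x = cosh d - exp (-(d * x)) - x * sinh d := by
  have h1 := sq_mul_expMoment (d * (1 + x))
  have h2 := sq_mul_expMoment (-(d * (1 - x)))
  have e1 : exp d * exp (-(d * (1 + x))) = exp (-(d * x)) := by rw [← exp_add]; ring_nf
  have e2 : exp (-d) * exp (- -(d * (1 - x))) = exp (-(d * x)) := by rw [← exp_add]; ring_nf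
  rw [chordGap, cosh_eq, sinh_eq]
  linear_combination (1 - x) / 2 * exp d * h1 + (1 + x) / 2 * exp (-d) * h2
    - (1 - x) / 2 * (1 + d * (1 + x)) * e1 - (1 + x) / 2 * (1 - d * (1 - x)) * e2

/-- The angular speed of the even wave `√(1 - c / sinhQuot d * e^{-d cos θ})`, where
`c = 1 - ω`. -/
noncomputable def evenSpeed (c d θ : ℝ) : ℝ :=
  2 * √(1 - c / sinhQuot d * exp (-(d * cos θ))) *
    (exp (d * cos θ) * √(chordGap d (cos θ) * (sinhQuot d / c)))

lemma continuous_evenSpeed_factor (c : ℝ) : Continuous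
    (Function.uncurry fun d θ => exp (d * cos θ) * √(chordGap d (cos θ) * (sinhQuot d / c))) := by
  have h1 := continuous_sinhQuot
  have h2 : Continuous fun p : ℝ × ℝ => chordGap p.1 (cos p.2) :=
    continuous_chordGap.comp (by fun_prop : Continuous fun p : ℝ × ℝ => (p.1, cos p.2))
  unfold Function.uncurry
  fun_prop

lemma continuous_evenSpeed (c : ℝ) : Continuous (Function.uncurry (evenSpeed c)) := by
  have h1 : Continuous fun p : ℝ × ℝ => c / sinhQuot p.1 :=
    continuous_const.div (continuous_sinhQuot.comp continuous_fst) fun p => (sinhQuot_pos _).ne'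
  have h2 : Continuous fun p : ℝ × ℝ => 2 * √(1 - c / sinhQuot p.1 * exp (-(p.1 * cos p.2))) := by
    fun_prop
  exact h2.mul (continuous_evenSpeed_factor c)

lemma evenSpeed_periodic (c d : ℝ) : Function.Periodic (evenSpeed c d) (2 * π) := fun θ => by
  simp [evenSpeed]

/-- The worst case is `cos θ = -1`, the minimum of the wave; `h` says that this minimum is positive.
-/
lemma mul_exp_lt_one {c d : ℝ} (hc : 0 < c) (hd : 0 ≤ d) (h : c * exp d < sinhQuot d) (θ : ℝ) :
    c / sinhQuot d * exp (-(d * cos θ)) < 1 := by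
  have hS := sinhQuot_pos d
  rw [div_mul_eq_mul_div, div_lt_one hS]
  refine lt_of_le_of_lt ?_ h
  gcongr
  nlinarith [neg_one_le_cos θ]

lemma evenSpeed_pos {c d : ℝ} (hc : 0 < c) (hd : 0 ≤ d) (h : c * exp d < sinhQuot d) (θ : ℝ) :
    0 < evenSpeed c d θ := by
  have h1 := sub_pos.2 (mul_exp_lt_one hc hd h θ)
  have h2 := chordGap_pos d (neg_one_le_cos θ) (cos_le_one θ)
  have hS := sinhQuot_pos d
  unfold evenSpeed
  positivity

/-- If the lowest point of the even wave is at rest at the origin, then its angular speed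
vanishes linearly at `π`. -/
lemma evenSpeed_le {c q : ℝ} (hq : 0 ≤ q) (h : sinhQuot q ≤ c * exp q) :
    ∃ C, 0 < C ∧ ∀ θ ∈ Icc 0 (2 * π), evenSpeed c q θ ≤ C * |θ - π| := by
  have hcont := (continuous_evenSpeed_factor c).comp
    (by fun_prop : Continuous fun θ : ℝ => (q, θ))
  obtain ⟨M, hM⟩ := (isCompact_Icc (a := (0 : ℝ)) (b := 2 * π)).bddAbove_image hcont.continuousOn
  have hM0 : 0 ≤ max M 0 := le_max_right _ _
  refine ⟨2 * √q * max M 0 + 1, by positivity, fun θ hθ => ?_⟩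
  have hS := sinhQuot_pos q
  have h1 : 1 - c / sinhQuot q * exp (-(q * cos θ)) ≤ q * |θ - π| ^ 2 := by
    have h2 : exp (-q) ≤ c / sinhQuot q := by
      rw [le_div_iff₀ hS, exp_neg, inv_mul_le_iff₀ (exp_pos q)]
      linarith
    have h3 : 1 - q * (1 + cos θ) ≤ exp (-q) * exp (-(q * cos θ)) := by
      rw [← exp_add]
      have := add_one_le_exp (-q + -(q * cos θ))
      linarith
    have h4 := mul_le_mul_of_nonneg_right h2 (exp_pos (-(q * cos θ))).le
    have h5 := one_sub_sq_div_two_le_cos (x := θ - π)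
    rw [cos_sub_pi] at h5
    have h6 : 1 + cos θ ≤ (θ - π) ^ 2 := by nlinarith [sq_nonneg (θ - π)]
    rw [sq_abs]
    have := mul_le_mul_of_nonneg_left h6 hq
    linarith
  have h2 : √(1 - c / sinhQuot q * exp (-(q * cos θ))) ≤ √q * |θ - π| := by
    refine (sqrt_le_sqrt h1).trans_eq ?_
    rw [sqrt_mul hq, sqrt_sq (abs_nonneg _)]
  have h3 : exp (q * cos θ) * √(chordGap q (cos θ) * (sinhQuot q / c)) ≤ max M 0 :=
    le_max_of_le_left (hM ⟨θ, hθ, rfl⟩)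
  calc evenSpeed c q θ ≤ 2 * (√q * |θ - π|) * max M 0 := by
        unfold evenSpeed
        gcongr
    _ ≤ (2 * √q * max M 0 + 1) * |θ - π| := by
        have := abs_nonneg (θ - π)
        nlinarith

/-- Amplitudes of even waves with prescribed period `L`. -/
lemma exists_evenSpeed {L ω : ℝ} (hL : 0 < L) (hω : evenThreshold L < ω) (hω1 : ω < 1) :
    ∃ d, 0 < d ∧ (1 - ω) * exp d < sinhQuot d ∧
      arrivalTime (evenSpeed (1 - ω) d) (2 * π) = L := by
  have hpi := pi_pos
  have hc : 0 < 1 - ω := by linarith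
  have hω' : 2 * π ^ 2 * (1 - ω) < (1 - (1 - ω)) * L ^ 2 := by
    unfold evenThreshold at hω
    rw [div_lt_iff₀ (by positivity)] at hω
    linarith
  generalize 1 - ω = c at *
  -- The threshold forces `ω > 0`.
  have hc1 : c < 1 := by
    by_contra! h
    nlinarith [sq_nonneg L, mul_pos (sq_pos_of_pos hpi) hc]
  have hcont := continuous_sinhQuot
  have hcomp : IsCompact (Icc 0 c⁻¹ ∩ {d | sinhQuot d ≤ c * exp d}) :=
    isCompact_Icc.inter_right (isClosed_le hcont (by fun_prop))
  -- `q` is the first parameter at which the wave touches `0`. It exists because at `d = c⁻¹` the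
  -- condition reads `c * sinh d ≤ c * exp d`.
  obtain ⟨q, ⟨hq0, hq1⟩, hq⟩ := hcomp.exists_isLeast ⟨c⁻¹, ⟨by positivity, le_rfl⟩, by
    have h := mul_sinhQuot c⁻¹
    rw [inv_mul_eq_iff_eq_mul₀ hc.ne'] at h
    simp only [mem_ofPred_eq]
    rw [h, sinh_eq]
    have := exp_pos c⁻¹
    have := exp_pos (-c⁻¹)
    gcongr
    linarith⟩
  simp only [mem_ofPred_eq] at hq1
  have hlt : ∀ d, 0 ≤ d → d < q → c * exp d < sinhQuot d := fun d hd hdq => by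
    by_contra! h
    exact absurd (hq ⟨⟨hd, hdq.le.trans hq0.2⟩, h⟩) (not_le.2 hdq)
  have hqpos : 0 < q := hq0.1.lt_of_ne (by
    rintro rfl
    simp [sinhQuot_zero] at hq1
    linarith)
  obtain ⟨C, hC, hle⟩ := evenSpeed_le hq0.1 hq1
  have hblow := eventually_lt_arrivalTime (continuous_evenSpeed c) hC
    (fun θ => by unfold evenSpeed; positivity) hle L
  obtain ⟨b, hb, hb0, hbq⟩ := ((hblow.filter_mono nhdsWithin_le_nhds).and
    (Ioo_mem_nhdsLT hqpos)).exists
  have hpos : ∀ d ∈ Icc 0 b, ∀ θ, 0 < evenSpeed c d θ := fun d hd =>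
    evenSpeed_pos hc hd.1 (hlt d hd.1 (hd.2.trans_lt hbq))
  -- At `d = 0` the speed is a constant `s` with `s² = 2ω / (1 - ω)`, the squared frequency of the
  -- linearization at `√ω`.
  have hT0 : arrivalTime (evenSpeed c 0) (2 * π) < L := by
    set s := 2 * √(1 - c) * √(1 / 2 * (1 / c)) with hs
    have h1 : arrivalTime (evenSpeed c 0) (2 * π) = 2 * π * s⁻¹ := by
      simp [arrivalTime, evenSpeed, sinhQuot_zero, chordGap_zero, hs]
      ring
    have hc1' : 0 < 1 - c := sub_pos.2 hc1
    have h2 : 0 < s := by positivity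
    have h3 : s ^ 2 = 2 * (1 - c) / c := by
      rw [hs, mul_pow, mul_pow, sq_sqrt hc1'.le, sq_sqrt (by positivity)]
      field_simp
    rw [h1, ← div_eq_mul_inv, div_lt_iff₀ h2]
    refine lt_of_pow_lt_pow_left₀ 2 (by positivity) ?_
    rw [mul_pow L, h3, mul_div_assoc', lt_div_iff₀ hc]
    linarith
  obtain ⟨d, hd, hdL⟩ := exists_arrivalTime_eq (continuous_evenSpeed c) hb0.le hpos
    (mem_uIcc_of_le hT0.le (hb (hpos b (right_mem_Icc.2 hb0.le))).le)
  refine ⟨d, hd.1.lt_of_ne ?_, hlt d hd.1 (hd.2.trans_lt hbq), hdL⟩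
  rintro rfl
  exact hT0.ne hdL

lemma exists_even_wave {L ω : ℝ} (hL : 0 < L) (hω : evenThreshold L < ω) (hω1 : ω < 1) :
    ∃ φ : ℝ → ℝ, IsEvenWave ω L 0 φ := by
  obtain ⟨d, hd0, hlt, hT⟩ := exists_evenSpeed hL hω hω1
  have hc : 0 < 1 - ω := by linarith
  have hS := sinhQuot_pos d
  have hpos := evenSpeed_pos hc hd0.le hlt
  have hlt1 := mul_exp_lt_one hc hd0.le hlt
  have hG := (continuous_evenSpeed (1 - ω)).uncurry_left d
  set G := evenSpeed (1 - ω) d with hGdef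
  have hper : Function.Periodic G (2 * π) := evenSpeed_periodic _ d
  obtain ⟨Θ, hmono, hd, hleft, hright⟩ := exists_motion hG hpos hper
  have heven : ∀ θ, G (-θ) = G θ := fun θ => by simp [hGdef, evenSpeed]
  have hneg : ∀ t, Θ (-t) = -Θ t := fun t => by
    rw [← hleft (-Θ t), arrivalTime_neg heven, hright]
  have hadd : ∀ t, Θ (t + L) = Θ t + 2 * π := fun t => by
    rw [← hleft (Θ t + 2 * π), arrivalTime_add_two_pi hG hpos hper, hright, hT]
  have hΘ0 : Θ 0 = 0 := by simpa [arrivalTime] using hleft 0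
  have hΘc : Continuous Θ := continuous_iff_continuousAt.2 fun t => (hd t).continuousAt
  obtain ⟨κ, hκdef⟩ : ∃ κ, (1 - ω) / sinhQuot d = κ := ⟨_, rfl⟩
  simp only [hκdef] at hlt1
  have hκ : 0 < κ := hκdef ▸ by positivity
  have hκinv : sinhQuot d / (1 - ω) = κ⁻¹ := by rw [← hκdef, inv_div]
  have hκd : κ * sinh d = (1 - ω) * d := by
    rw [← mul_sinhQuot, ← hκdef]
    field_simp
  have hw : ∀ t, 0 < 1 - κ * exp (-(d * cos (Θ t))) := fun t => sub_pos.2 (hlt1 _)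
  have hQ : ∀ t, 0 < chordGap d (cos (Θ t)) := fun t =>
    chordGap_pos d (neg_one_le_cos _) (cos_le_one _)
  have hsq : ∀ t, √(1 - κ * exp (-(d * cos (Θ t)))) ^ 2 = 1 - κ * exp (-(d * cos (Θ t))) :=
    fun t => sq_sqrt (hw t).le
  have hrange : ∀ t, √(1 - κ * exp (-(d * cos (Θ t)))) ^ 2 < 1 := fun t => by
    rw [hsq]
    have := exp_pos (-(d * cos (Θ t)))
    have := mul_pos hκ this
    linarith
  have hQc : Continuous fun t => chordGap d (cos (Θ t)) :=
    continuous_chordGap.comp (by fun_prop : Continuous fun t : ℝ => (d, cos (Θ t)))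
  -- The choice `κ = (1 - ω) / sinhQuot d`, that is `hκd`, gives the points `cos Θ = ±1` the same
  -- energy; `E` is the constant that makes both turning points.
  obtain ⟨hsmooth, hode⟩ := profile_of_energy (ω := ω)
    (u := fun t => √(1 - κ * exp (-(d * cos (Θ t)))))
    (v := fun t => -(κ * d * sin (Θ t) * √(chordGap d (cos (Θ t)) * κ⁻¹)))
    (E := κ * cosh d - 1 - (1 - ω) * log κ)
    (by fun_prop) (fun t => by
      refine ((((((hd t).cos.const_mul d).neg.exp).const_mul κ).const_sub 1).sqrt
        (hw t).ne').congr_deriv ?_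
      have h1 := sqrt_pos.2 (hw t)
      rw [div_eq_iff (by positivity), hGdef, evenSpeed, hκinv, hκdef]
      have e : exp (-(d * cos (Θ t))) * exp (d * cos (Θ t)) = 1 := by
        rw [← exp_add, neg_add_cancel, exp_zero]
      linear_combination (-2 * κ * d * sin (Θ t) * √(1 - κ * exp (-(d * cos (Θ t)))) *
        √(chordGap d (cos (Θ t)) * κ⁻¹)) * e) hrange (fun t => by
      have h1 := mul_chordGap d (cos (Θ t))
      rw [hsq, sub_sub_cancel, log_mul hκ.ne' (exp_pos _).ne', log_exp, neg_sq, mul_pow,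
        sq_sqrt (mul_pos (hQ t) (inv_pos.2 hκ)).le, mul_pow, sin_sq]
      have h2 : κ * κ⁻¹ = 1 := mul_inv_cancel₀ hκ.ne'
      linear_combination κ * h1 - cos (Θ t) * hκd +
        κ * d ^ 2 * (1 - cos (Θ t) ^ 2) * chordGap d (cos (Θ t)) * h2)
    ((countable_setOf_sin_eq_zero.preimage hmono.injective).mono fun t ht => by
      have h1 := (sqrt_pos.2 (mul_pos (hQ t) (inv_pos.2 hκ))).ne'
      simpa [hκ.ne', hd0.ne', h1] using ht)
  refine ⟨fun t => √(1 - κ * exp (-(d * cos (Θ t)))), ⟨⟨hsmooth, ⟨⟨hL, fun t => ?_⟩,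
    fun T ⟨hT0, hTper⟩ => ?_⟩, hode⟩, fun t => ⟨sqrt_pos.2 (hw t), ?_⟩, fun t => ?_⟩⟩
  · simp [hadd]
  · by_contra! hTL
    have h1 := hTper 0
    simp only [zero_add] at h1
    rw [sqrt_inj (hw _).le (hw _).le, sub_right_inj, mul_right_inj' hκ.ne', exp_eq_exp, neg_inj,
      mul_right_inj' hd0.ne', hΘ0, cos_zero] at h1
    have h3 : Θ 0 < Θ T := hmono hT0
    have h4 : Θ T < Θ 0 + 2 * π := by rw [← hadd]; exact hmono (by linarith)
    rw [hΘ0] at h3 h4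
    have := (cos_eq_one_iff_of_lt_of_lt (by linarith) (by linarith)).1 h1
    linarith
  · exact ((sq_lt_one_iff₀ (sqrt_nonneg _)).1 (hrange t))
  · simp [hneg]

theorem theorem1 (L : ℝ) (hL : 0 < L) :
    (∀ ω : ℝ, evenThreshold L < ω → ω < 1 →
      ∃ φ : ℝ → ℝ, ∀ x₀ : ℝ, IsEvenWave ω L x₀ (fun x => φ (x - x₀))) ∧
    (∀ ω : ℝ, oddThreshold L < ω → ω < 1 →
      ∃ φ : ℝ → ℝ, ∀ x₀ : ℝ, IsOddWave ω L x₀ (fun x => φ (x - x₀))) := by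
  refine ⟨fun ω h h1 => ?_, fun ω h h1 => ?_⟩
  · obtain ⟨φ, hφ⟩ := exists_even_wave hL h h1
    exact ⟨φ, fun x₀ => ⟨hφ.toIsPeriodicProfile.comp_sub_const x₀, fun x => hφ.range _,
      fun x => by simpa using hφ.even x⟩⟩
  · obtain ⟨φ, hφ⟩ := exists_odd_wave hL h h1
    exact ⟨φ, fun x₀ => ⟨hφ.toIsPeriodicProfile.comp_sub_const x₀, fun x => hφ.range _,
      fun x => by simpa using hφ.odd x, fun x => by simpa using hφ.quarter x⟩⟩
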